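/- Let $\mathcal T$ be a metric space, let $h\colon\mathbb R^n\to\mathbb R$ be continuously differentiable, and let $f\colon\mathcal T\times\mathbb R^n\to\mathbb R$ be such that $t\mapsto f(t,x)$ is continuous for every $x$ and $x\mapsto f(t,x)$ is continuously differentiable for every $t$. Put $M(t):=\{x\in\mathbb R^n\mid f(t,x)\le 0\}$ and let $\bar x$ be a local minimizer of the problem $$\text{minimize } h(x)\quad\text{subject to } x\in M(t)\ \text{ for all } t\in\mathcal T$$ (so $\bar x$ is feasible, and $h(\bar x)\le h(x)$ for all feasible $x$ near $\bar x$). Let $\mathcal T_f:=\{t\in\mathcal T\mid f(t,\bar x)=0\}$ and assume that 1. $\bar x\in\operatorname{int}\bigcap_{t\in\mathcal T\setminus\mathcal T_f}\{x\in\mathbb R^n\mid f(t,x)<0\}$ (an intersection over the empty index set is $\mathbb R^n$); 2. $\nabla_x f(t,\bar x)\ne 0$ for all $t\in\mathcal T_f$, and $t\mapsto\nabla_x f(t,\bar x)$ is continuous on $\mathcal T_f$; 3. the conical hull intersection property (CHIP) holds at $\bar x$ over $\mathcal T_f$: $$T\Big(\bar x;\bigcap_{t\in\mathcal T_f}M(t)\Big)=\bigcap_{t\in\mathcal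 T_f}T\big(\bar x;M(t)\big),$$ where $T(\bar x;\Theta)$ is the set of all $v\in\mathbb R^n$ for which there are $\tau_k>0$ with $\tau_k\to0$ and $v_k\to v$ with $\bar x+\tau_kv_k\in\Theta$ for all $k$ (the contingent cone). Then for every finite measure $\nu$ on the Borel $\sigma$-algebra of $\mathcal T_f$ that is strictly positive (every nonempty relatively open subset of $\mathcal T_f$ has positive measure), $$0\in\nabla h(\bar x)+\operatorname{cl}\Big(\int_{\mathcal T_f}\operatorname{cone}\{\nabla_x f(t,\bar x)\}\,d\nu(t)\Big).$$ Here $\operatorname{cone}\{a\}=\{\lambda a\mid\lambda\ge 0\}$, and the integral is the Aumann integral: the set of all $\int_{\mathcal T_f}g\,d\nu$ with $g\colon\mathcal T_f\to\mathbb R^n$ $\nu$-integrable and $g(t)\in\operatorname{cone}\{\nabla_x f(t,\bar x)\}$ for $\nu$-a.e. $t$. -/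

import Mathlib

open Set Filter Topology MeasureTheory
open scoped Pointwise

namespace SemiInfinite

/-- The Bouligand–Severi tangent (contingent) cone `T(x; Θ)`, the Painlevé–Kuratowski outer limit
of `(Θ - x) / τ` as `τ ↓ 0`: all limits of `w k` with `x + τ k • w k ∈ Θ` and `τ k ↓ 0`. -/
def contingentCone {E : Type*} [NormedAddCommGroup E] [NormedSpace ℝ E]
    (x : E) (Θ : Set E) : Set E :=
  {v | ∃ (τ : ℕ → ℝ) (w : ℕ → E), (∀ k, 0 < τ k) ∧ Tendsto τ atTop (𝓝 0) ∧
    Tendsto w atTop (𝓝 v) ∧ ∀ k, x + τ k • w k ∈ Θ}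

/-- The conic hull `cone Θ = {r • x | r ≥ 0, x ∈ Θ}`. -/
def conicHull {E : Type*} [NormedAddCommGroup E] [NormedSpace ℝ E] (Θ : Set E) : Set E :=
  {y | ∃ r : ℝ, 0 ≤ r ∧ ∃ x ∈ Θ, y = r • x}

/-- The Aumann integral of a set-valued mapping: the set of the integrals of all its integrable
almost everywhere selections. -/
def aumannIntegral {Ω E : Type*} [MeasurableSpace Ω] [NormedAddCommGroup E] [NormedSpace ℝ E]
    (μ : Measure Ω) (M : Ω → Set E) : Set E :=
  {v | ∃ g : Ω → E, Integrable g μ ∧ (∀ᵐ ω ∂μ, g ω ∈ M ω) ∧ v = ∫ ω, g ω ∂μ}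

/-- The constraint set `M(t) = {x | f(t, x) ≤ 0}`. -/
def constraintSet {T E : Type*} (f : T → E → ℝ) (t : T) : Set E :=
  {x | f t x ≤ 0}

/-- The feasible set `{x | f(t, x) ≤ 0 for all t}` of the semi-infinite program. -/
def feasibleSet {T E : Type*} (f : T → E → ℝ) : Set E :=
  ⋂ t, constraintSet f t

/-- The active index set `{t | f(t, x) = 0}`. -/
def activeSet {T E : Type*} (f : T → E → ℝ) (x : E) : Set T :=
  {t | f t x = 0}

/-- The conical hull intersection property (CHIP) of a family of sets at `x` over the set `A` of
indices: `T(x; ⋂ t ∈ A, M t) = ⋂ t ∈ A, T(x; M t)`. -/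
def CHIP {T E : Type*} [NormedAddCommGroup E] [NormedSpace ℝ E]
    (M : T → Set E) (A : Set T) (x : E) : Prop :=
  contingentCone x (⋂ t ∈ A, M t) = ⋂ t ∈ A, contingentCone x (M t)

end SemiInfinite

open scoped NNReal

namespace SemiInfinite

section Cones

variable {E : Type*} [NormedAddCommGroup E] [NormedSpace ℝ E]

/-! The proof is by duality. The Aumann integral of the rays is a convex cone, so if `-∇h` lay
outside its closure, Hahn–Banach would give a functional nonpositive on the cone and positive at
`-∇h`; let `v` be its Riesz vector. Integrating the gradient field over small open sets, which have
positive measure, shows that `v` makes a nonpositive product with every active gradient. Nonzero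
gradients put `v` in each contingent cone, and CHIP puts it in that of the intersection. Inactive
constraints hold near the minimizer, so `v` is tangent to the feasible set, and local minimality
contradicts `⟨∇h, v⟩ < 0`. -/

theorem mem_posTangentConeAt_inter_of_mem_contingentCone {x v : E} {Θ U : Set E}
    (hv : v ∈ contingentCone x Θ) (hU : U ∈ 𝓝 x) : v ∈ posTangentConeAt (Θ ∩ U) x := by
  obtain ⟨τ, w, hpos, hτ, hw, hmem⟩ := hv
  have hd : Tendsto (fun k => τ k • w k) atTop (𝓝 0) := by simpa using hτ.smul hw
  have hxd : Tendsto (fun k => x + τ k • w k) atTop (𝓝 x) := by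
    simpa using hd.const_add x
  -- `posTangentConeAt` asks for scalars `c k` in `ℝ≥0` and displacements `d k → 0` with `c k • d k
  -- → v`; here `c k = (τ k)⁻¹` and `d k = τ k • w k`.
  refine mem_tangentConeAt_of_seq atTop (fun k => (⟨τ k, (hpos k).le⟩ : ℝ≥0)⁻¹)
    (fun k => τ k • w k) hd ?_ (hw.congr fun k => ?_)
  · filter_upwards [hxd hU] with k hk using ⟨hmem k, hk⟩
  · change w k = (τ k)⁻¹ • τ k • w k
    rw [inv_smul_smul₀ (hpos k).ne']

theorem zero_mem_conicHull_singleton (a : E) : (0 : E) ∈ conicHull {a} :=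
  ⟨0, le_rfl, a, rfl, (zero_smul ℝ a).symm⟩

theorem self_mem_conicHull_singleton (a : E) : a ∈ conicHull {a} :=
  ⟨1, zero_le_one, a, rfl, (one_smul ℝ a).symm⟩

theorem add_mem_conicHull_singleton {a y z : E} (hy : y ∈ conicHull {a})
    (hz : z ∈ conicHull {a}) : y + z ∈ conicHull {a} := by
  obtain ⟨r, hr, _, rfl, rfl⟩ := hy
  obtain ⟨s, hs, _, rfl, rfl⟩ := hz
  exact ⟨r + s, add_nonneg hr hs, _, rfl, (add_smul r s _).symm⟩

theorem smul_mem_conicHull_singleton {a y : E} {c : ℝ} (hc : 0 ≤ c)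
    (hy : y ∈ conicHull {a}) : c • y ∈ conicHull {a} := by
  obtain ⟨r, hr, _, rfl, rfl⟩ := hy
  exact ⟨c * r, mul_nonneg hc hr, _, rfl, smul_smul c r _⟩

end Cones

section AumannIntegral

variable {Ω E : Type*} [MeasurableSpace Ω] [NormedAddCommGroup E] [NormedSpace ℝ E]
  {μ : Measure Ω} {a : Ω → E}

theorem zero_mem_aumannIntegral_conicHull :
    (0 : E) ∈ aumannIntegral μ fun ω => conicHull {a ω} :=
  ⟨0, integrable_zero _ _ _, .of_forall fun ω => zero_mem_conicHull_singleton (a ω), by simp⟩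

theorem smul_mem_aumannIntegral_conicHull {c : ℝ} (hc : 0 ≤ c) {y : E}
    (hy : y ∈ aumannIntegral μ fun ω => conicHull {a ω}) :
    c • y ∈ aumannIntegral μ fun ω => conicHull {a ω} := by
  obtain ⟨g, hg, hga, rfl⟩ := hy
  exact ⟨fun ω => c • g ω, hg.smul c, hga.mono fun ω => smul_mem_conicHull_singleton hc,
    (integral_smul c g).symm⟩

theorem add_mem_aumannIntegral_conicHull {y z : E}
    (hy : y ∈ aumannIntegral μ fun ω => conicHull {a ω})
    (hz : z ∈ aumannIntegral μ fun ω => conicHull {a ω}) :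
    y + z ∈ aumannIntegral μ fun ω => conicHull {a ω} := by
  obtain ⟨g, hg, hga, rfl⟩ := hy
  obtain ⟨k, hk, hka, rfl⟩ := hz
  refine ⟨fun ω => g ω + k ω, hg.add hk, ?_, (integral_add hg hk).symm⟩
  filter_upwards [hga, hka] with ω h₁ h₂ using add_mem_conicHull_singleton h₁ h₂

theorem convex_aumannIntegral_conicHull :
    Convex ℝ (aumannIntegral μ fun ω => conicHull {a ω}) :=
  fun _ hy _ hz _ _ hc hd _ => add_mem_aumannIntegral_conicHull
    (smul_mem_aumannIntegral_conicHull hc hy) (smul_mem_aumannIntegral_conicHull hd hz)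

/-- Cutting `a` off to zero outside `U` still selects from the rays, since each contains both `a ω`
and `0`. These are the test elements that localize information about the integral. -/
theorem setIntegral_mem_aumannIntegral_conicHull {U : Set Ω} (hU : MeasurableSet U)
    (ha : IntegrableOn a U μ) :
    ∫ ω in U, a ω ∂μ ∈ aumannIntegral μ fun ω => conicHull {a ω} := by
  refine ⟨U.indicator a, (integrable_indicator_iff hU).2 ha, .of_forall fun ω => ?_,
    (integral_indicator hU).symm⟩
  by_cases hω : ω ∈ U
  · simpa [hω] using self_mem_conicHull_singleton (a ω)
  · simpa [hω] using zero_mem_conicHull_singleton (a ω)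

/-- A functional separating a point from the closure of the Aumann integral of the rays spanned
by `a` is nonpositive on that integral and positive at the point. -/
theorem exists_polar_of_notMem_closure_aumannIntegral {y : E}
    (hy : y ∉ closure (aumannIntegral μ fun ω => conicHull {a ω})) :
    ∃ l : StrongDual ℝ E,
      (∀ z ∈ aumannIntegral μ fun ω => conicHull {a ω}, l z ≤ 0) ∧ 0 < l y := by
  obtain ⟨l, u, hl, hu⟩ := geometric_hahn_banach_closed_point
    (convex_aumannIntegral_conicHull (μ := μ) (a := a)).closure isClosed_closure hy
  have hu0 : 0 < u := by
    simpa using hl 0 (subset_closure zero_mem_aumannIntegral_conicHull)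
  refine ⟨l, fun z hz => ?_, hu0.trans hu⟩
  by_contra! hpos
  -- A positive value `l z` could be rescaled to exactly `u`, but `l < u` on the whole cone.
  have key := hl _ (subset_closure
    (smul_mem_aumannIntegral_conicHull (div_pos hu0 hpos).le hz))
  rw [map_smul, smul_eq_mul, div_mul_cancel₀ _ hpos.ne'] at key
  exact key.false

/-- A functional that is nonpositive on the Aumann integral of the rays spanned by a continuous
field `a` is nonpositive on `a` everywhere, if the measure is strictly positive. -/
theorem apply_nonpos_of_forall_aumannIntegral_nonpos [TopologicalSpace Ω]
    [OpensMeasurableSpace Ω] [CompleteSpace E] [SecondCountableTopologyEither Ω E]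
    [IsFiniteMeasure μ] [μ.IsOpenPosMeasure]
    (ha : Continuous a) {l : StrongDual ℝ E}
    (hl : ∀ z ∈ aumannIntegral μ fun ω => conicHull {a ω}, l z ≤ 0) (ω : Ω) :
    l (a ω) ≤ 0 := by
  by_contra! hω
  -- The norm bound makes `a` integrable on `U`; `a` need not be integrable globally.
  set U : Set Ω := {t | 0 < l (a t)} ∩ {t | ‖a t‖ < ‖a ω‖ + 1}
  have hUo : IsOpen U := (isOpen_lt continuous_const (l.continuous.comp ha)).inter
    (isOpen_lt ha.norm continuous_const)
  have hωU : ω ∈ U := ⟨hω, lt_add_one ‖a ω‖⟩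
  have hint : IntegrableOn a U μ := by
    refine Measure.integrableOn_of_bounded (M := ‖a ω‖ + 1) (measure_ne_top μ U)
      ha.aestronglyMeasurable ?_
    filter_upwards [ae_restrict_mem hUo.measurableSet] with t ht using ht.2.le
  have hpos : 0 < ∫ t in U, l (a t) ∂μ := by
    rw [setIntegral_pos_iff_support_of_nonneg_ae ?_ (l.integrable_comp hint)]
    · have : (Function.support fun t => l (a t)) ∩ U = U :=
        inter_eq_right.2 fun t ht => ht.1.ne'
      rw [this]
      exact hUo.measure_pos μ ⟨ω, hωU⟩
    · filter_upwards [ae_restrict_mem hUo.measurableSet] with t ht using ht.1.le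
  rw [l.integral_comp_comm hint] at hpos
  exact (hl _ (setIntegral_mem_aumannIntegral_conicHull hUo.measurableSet hint)).not_gt hpos

end AumannIntegral

section Constraint

theorem eventually_apply_add_smul_neg {E : Type*} [NormedAddCommGroup E] [NormedSpace ℝ E]
    {φ : E → ℝ} {φ' : StrongDual ℝ E} {x v : E}
    (hφ : HasFDerivAt φ φ' x) (hx : φ x = 0) (hv : φ' v < 0) :
    ∀ᶠ τ : ℝ in 𝓝[>] 0, φ (x + τ • v) < 0 := by
  have hlim := (hφ.hasLineDerivAt v).tendsto_slope_zero_right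
  filter_upwards [hlim.eventually_lt_const hv, self_mem_nhdsWithin] with τ hτ hpos
  rw [hx, sub_zero, smul_eq_mul] at hτ
  exact (pos_iff_neg_of_mul_neg hτ).1 (inv_pos.2 hpos)

variable {E : Type*} [NormedAddCommGroup E] [InnerProductSpace ℝ E] [CompleteSpace E]

/-- At an active point with nonzero gradient, the contingent cone of the sublevel set contains
the half-space of directions along which the derivative is nonpositive. -/
theorem mem_contingentCone_sublevel {φ : E → ℝ} {x v : E} (hφ : DifferentiableAt ℝ φ x)
    (hx : φ x = 0) (hne : gradient φ x ≠ 0) (hv : fderiv ℝ φ x v ≤ 0) :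
    v ∈ contingentCone x {y | φ y ≤ 0} := by
  -- Tilting `v` slightly against the gradient makes the derivative strictly negative, so short
  -- steps stay in the sublevel set. The tilt and the step bound both vanish as `k → ∞`.
  have hdir : ∀ k : ℕ, ∃ τ : ℝ, (0 < τ ∧ τ < 1 / ((k : ℝ) + 1)) ∧
      φ (x + τ • (v - (1 / ((k : ℝ) + 1)) • gradient φ x)) < 0 := by
    intro k
    have hk : (0 : ℝ) < 1 / ((k : ℝ) + 1) := Nat.one_div_pos_of_nat
    have hneg : fderiv ℝ φ x (v - (1 / ((k : ℝ) + 1)) • gradient φ x) < 0 := by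
      have hg : fderiv ℝ φ x (gradient φ x) = ‖gradient φ x‖ ^ 2 := by
        rw [← toDual_gradient, InnerProductSpace.toDual_apply_apply, real_inner_self_eq_norm_sq]
      rw [map_sub, map_smul, hg, smul_eq_mul]
      have : 0 < ‖gradient φ x‖ ^ 2 := pow_pos (norm_pos_iff.2 hne) 2
      linarith [mul_pos hk this]
    have hsmall : ∀ᶠ τ : ℝ in 𝓝[>] 0, τ ∈ Ioo 0 (1 / ((k : ℝ) + 1)) := Ioo_mem_nhdsGT hk
    exact (hsmall.and (eventually_apply_add_smul_neg hφ.hasFDerivAt hx hneg)).exists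
  choose τ hτ hmem using hdir
  refine ⟨τ, fun k => v - (1 / ((k : ℝ) + 1)) • gradient φ x, fun k => (hτ k).1, ?_, ?_,
    fun k => (hmem k).le⟩
  · exact squeeze_zero (fun k => (hτ k).1.le) (fun k => (hτ k).2.le)
      tendsto_one_div_add_atTop_nhds_zero_nat
  · simpa using tendsto_const_nhds.sub
      ((tendsto_one_div_add_atTop_nhds_zero_nat (𝕜 := ℝ)).smul_const (gradient φ x))

/-- The linearized directions at a local minimizer are not descent directions, under CHIP. -/
theorem fderiv_nonneg_of_forall_active_nonpos {T : Type*} {h : E → ℝ} {f : T → E → ℝ} {x v : E}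
    (hh : DifferentiableAt ℝ h x) (hf : ∀ t, DifferentiableAt ℝ (f t) x)
    (locmin : IsLocalMinOn h (feasibleSet f) x)
    (inactive : x ∈ interior (⋂ t ∈ (activeSet f x)ᶜ, {y | f t y < 0}))
    (grad_ne : ∀ t ∈ activeSet f x, gradient (f t) x ≠ 0)
    (chip : CHIP (constraintSet f) (activeSet f x) x)
    (hv : ∀ t ∈ activeSet f x, fderiv ℝ (f t) x v ≤ 0) :
    0 ≤ fderiv ℝ h x v := by
  have hcone : v ∈ contingentCone x (⋂ t ∈ activeSet f x, constraintSet f t) := by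
    rw [CHIP] at chip
    rw [chip]
    exact mem_iInter₂.2 fun t ht =>
      mem_contingentCone_sublevel (hf t) ht (grad_ne t ht) (hv t ht)
  -- Within the neighborhood of `x` where all inactive constraints are negative, the active
  -- constraints alone ensure feasibility.
  refine locmin.hasFDerivWithinAt_nonneg hh.hasFDerivAt.hasFDerivWithinAt
    (posTangentConeAt_mono ?_ (mem_posTangentConeAt_inter_of_mem_contingentCone hcone
      (mem_interior_iff_mem_nhds.1 inactive)))
  rintro y ⟨hact, hinact⟩
  refine mem_iInter.2 fun t => ?_
  by_cases ht : t ∈ activeSet f x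
  · exact mem_iInter₂.1 hact t ht
  · exact le_of_lt (show f t y < 0 from mem_iInter₂.1 hinact t ht)

end Constraint

end SemiInfinite

theorem theorem7p3 {T : Type*} [MetricSpace T] [MeasurableSpace T] [BorelSpace T] {n : ℕ}
    (h : EuclideanSpace ℝ (Fin n) → ℝ) (f : T → EuclideanSpace ℝ (Fin n) → ℝ)
    (xbar : EuclideanSpace ℝ (Fin n))
    (h_smooth : ContDiff ℝ 1 h)
    (f_cont : ∀ x, Continuous fun t => f t x)
    (f_smooth : ∀ t, ContDiff ℝ 1 (f t))
    (feasible : xbar ∈ SemiInfinite.feasibleSet f)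
    (locmin : IsLocalMinOn h (SemiInfinite.feasibleSet f) xbar)
    (inactive : xbar ∈ interior (⋂ t ∈ (SemiInfinite.activeSet f xbar)ᶜ, {x | f t x < 0}))
    (grad_ne : ∀ t ∈ SemiInfinite.activeSet f xbar, gradient (f t) xbar ≠ 0)
    (grad_cont : ContinuousOn (fun t => gradient (f t) xbar) (SemiInfinite.activeSet f xbar))
    (chip : SemiInfinite.CHIP (SemiInfinite.constraintSet f) (SemiInfinite.activeSet f xbar) xbar)
    (ν : Measure (SemiInfinite.activeSet f xbar)) [IsFiniteMeasure ν] [ν.IsOpenPosMeasure] :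
    (0 : EuclideanSpace ℝ (Fin n)) ∈ ({gradient h xbar} : Set (EuclideanSpace ℝ (Fin n))) +
      closure (SemiInfinite.aumannIntegral ν
        fun t => SemiInfinite.conicHull {gradient (f t) xbar}) := by
  have hgrad : Continuous fun t : SemiInfinite.activeSet f xbar => gradient (f t) xbar :=
    continuousOn_iff_continuous_domRestrict.1 grad_cont
  rw [Set.singleton_add]
  refine ⟨-gradient h xbar, ?_, add_neg_cancel _⟩
  by_contra hsep
  obtain ⟨l, hl, hlpos⟩ := SemiInfinite.exists_polar_of_notMem_closure_aumannIntegral hsep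
  -- With the Riesz vector of `l` as direction, values of `l` at gradients become directional
  -- derivatives.
  set v := (InnerProductSpace.toDual ℝ (EuclideanSpace ℝ (Fin n))).symm l with hv
  have hpair : ∀ φ : EuclideanSpace ℝ (Fin n) → ℝ,
      fderiv ℝ φ xbar v = l (gradient φ xbar) := fun φ => by
    rw [← toDual_gradient, InnerProductSpace.toDual_apply_apply, real_inner_comm, hv,
      InnerProductSpace.toDual_symm_apply]
  have hnonneg := SemiInfinite.fderiv_nonneg_of_forall_active_nonpos (v := v)
    (h_smooth.differentiable one_ne_zero xbar)
    (fun t => (f_smooth t).differentiable one_ne_zero xbar) locmin inactive grad_ne chip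
    fun t ht => by
      rw [hpair]
      exact SemiInfinite.apply_nonpos_of_forall_aumannIntegral_nonpos hgrad hl ⟨t, ht⟩
  rw [hpair] at hnonneg
  rw [map_neg] at hlpos
  linarith
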